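/- Let $\lambda$ be a limit ordinal and let $j\colon V_\lambda\to V_\lambda$ be an elementary embedding of the structure $(V_\lambda,\in)$ into itself, not the identity. For elementary embeddings $e,k\colon V_\lambda\to V_\lambda$ let $e(k)=\bigcup_{\alpha<\lambda}e(k\restriction V_\alpha)$, which is again an elementary embedding $V_\lambda\to V_\lambda$, and let $\operatorname{crit}e$ be the least ordinal moved by $e$. Put $j_{(1)}=j$, $j_{(n+1)}=j_{(n)}(j)$, $\kappa_0=\operatorname{crit}j$, $\kappa_{i+1}=j(\kappa_i)$, $\kappa_i^n=j_{(n)}(\kappa_i)$ and $\kappa_{2.5}=j_{(3)}(\kappa_1)$. In the table below, an entry $\alpha_0\mapsto\alpha_1\mapsto\cdots\mapsto\alpha_m$ in row $n$ means that $\alpha_0=\operatorname{crit}j_{(n)}$ and $j_{(n)}(\alpha_i)=\alpha_{i+1}$ for $i<m$; a final entry "$\mapsto{>}\kappa_4$" means that the last listed ordinal is sent by $j_{(n)}$ to an ordinal greater than $\kappa_4$. Then the following holds. $$\begin{array}{r|l|l} n&\text{Critical sequence of }j_{(n)}&\text{Other values}\\\hline 1&\kappa_0\mapsto\kappa_1\mapsto\kappa_2\mapsto\kappa_3\mapsto\kappa_4&\\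 2&\kappa_1\mapsto\kappa_2\mapsto\kappa_3\mapsto\kappa_4&\\ 3&\kappa_0\mapsto\kappa_2\mapsto\kappa_3\mapsto\kappa_4&\kappa_1\mapsto\kappa_{2.5}\\ 4&\kappa_2\mapsto\kappa_{2.5}\mapsto\kappa_3\mapsto\kappa_4&\\ 5&\kappa_0\mapsto\kappa_1\mapsto\kappa_{2.5}\mapsto\kappa_4&\\ 6&\kappa_1\mapsto\kappa_{2.5}\mapsto\kappa_2^5\mapsto{>}\kappa_4&\\ 7&\kappa_0\mapsto\kappa_{2.5}\mapsto\kappa_2^6\mapsto\kappa_3^6\mapsto{>}\kappa_4&\kappa_1\mapsto\kappa_3\\ 8&\kappa_{2.5}\mapsto\kappa_3\mapsto\kappa_2^7\mapsto\kappa_3^7\mapsto{>}\kappa_4&\\ 9&\kappa_0\mapsto\kappa_1\mapsto\kappa_2\mapsto\kappa_2^7\mapsto{>}\kappa_4&\\ 10&\kappa_1\mapsto\kappa_2\mapsto\kappa_2^7\mapsto\kappa_3^9\mapsto{>}\kappa_4&\\ 11&\kappa_0\mapsto\kappa_2\mapsto\kappa_2^7\mapsto\kappa_3^{10}\mapsto{>}\kappa_4&\kappa_1\mapsto\kappa_3\\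 12&\kappa_2\mapsto\kappa_3\mapsto\kappa_2^7\mapsto\kappa_3^{11}\mapsto{>}\kappa_4&\\ 13&\kappa_0\mapsto\kappa_1\mapsto\kappa_3\mapsto\kappa_2^7\mapsto{>}\kappa_4&\\ 14&\kappa_1\mapsto\kappa_3\mapsto\kappa_2^{13}\mapsto\kappa_2^7\mapsto{>}\kappa_4&\\ 15&\kappa_0\mapsto\kappa_3\mapsto\kappa_2^{14}\mapsto\kappa_2^{13}\mapsto{>}\kappa_4&\\ 16&\kappa_3\mapsto\kappa_1^{15}\mapsto\kappa_2^{15}\mapsto\kappa_2^{14}\mapsto{>}\kappa_4& \end{array}$$ Moreover, $j_{(n-1)}(\kappa_4)>\kappa_4$ for $7\le n\le 16$. -/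

import Mathlib

universe u

namespace RankEmb

open FirstOrder FirstOrder.Language ZFSet Order Ordinal

/-! ### The structure `(V_lam, ∈)` and its elementary self-embeddings -/

/-- The relation symbols of the language of set theory: one binary symbol. -/
inductive SetRel : ℕ → Type
  | mem : SetRel 2

/-- The first-order language of set theory (equality is a logical symbol). -/
def LSet : FirstOrder.Language.{0, 0} := ⟨fun _ => Empty, SetRel⟩

/-- The membership symbol. -/
def LSet.memSymb : LSet.Relations 2 := SetRel.mem

/-- The rank `V_lam` of the cumulative hierarchy, as a type. -/
abbrev Rk (lam : Ordinal.{u}) : Type (u + 1) := {x : ZFSet.{u} // x ∈ V_ lam}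

/-- `V_lam` as a structure for the language of set theory, with the true membership relation. -/
instance rkStructure (lam : Ordinal.{u}) : LSet.Structure (Rk lam) where
  funMap := fun f => nomatch f
  RelMap := fun {_} r => match r with
    | SetRel.mem => fun v => (v 0).1 ∈ (v 1).1

/-- Elementary embeddings from `V_lam` to itself. -/
abbrev Emb (lam : Ordinal.{u}) : Type (u + 1) := Rk lam ↪ₑ[LSet] Rk lam

/-- The identity embedding of `V_lam`. -/
abbrev Emb.id (lam : Ordinal.{u}) : Emb lam := ElementaryEmbedding.refl LSet (Rk lam)

/-! ### Predicates on `V_lam` given by first-order formulas -/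

/-- `P` is defined over `V_lam` by a first-order formula without parameters. -/
def FO {lam : Ordinal.{u}} {α : Type} (P : (α → Rk lam) → Prop) : Prop :=
  ∃ φ : LSet.Formula α, ∀ v, φ.Realize v ↔ P v

section FO

variable {lam : Ordinal.{u}} {α : Type} {P Q : (α → Rk lam) → Prop}

theorem FO.map (h : FO P) (e : Emb lam) (v : α → Rk lam) : P (e ∘ v) ↔ P v := by
  obtain ⟨φ, hφ⟩ := h
  rw [← hφ, ← hφ, e.map_formula]

theorem FO.mem (s t : α) : FO fun v : α → Rk lam => (v s).1 ∈ (v t).1 := by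
  refine ⟨Relations.formula (L := LSet) LSet.memSymb ![Term.var s, Term.var t], fun v => ?_⟩
  rw [Formula.realize_rel]
  rfl

theorem FO.eq (s t : α) : FO fun v : α → Rk lam => v s = v t :=
  ⟨Term.equal (Term.var s) (Term.var t), fun v => by simp [Formula.realize_equal]⟩

theorem FO.imp (hP : FO P) (hQ : FO Q) : FO fun v => P v → Q v := by
  obtain ⟨φ, hφ⟩ := hP
  obtain ⟨ψ, hψ⟩ := hQ
  exact ⟨φ.imp ψ, fun v => by rw [Formula.realize_imp, hφ, hψ]⟩

theorem FO.not (hP : FO P) : FO fun v => ¬ P v := by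
  obtain ⟨φ, hφ⟩ := hP
  exact ⟨φ.not, fun v => by rw [Formula.realize_not, hφ]⟩

theorem FO.and (hP : FO P) (hQ : FO Q) : FO fun v => P v ∧ Q v := by
  obtain ⟨φ, hφ⟩ := hP
  obtain ⟨ψ, hψ⟩ := hQ
  exact ⟨φ ⊓ ψ, fun v => by rw [Formula.realize_inf, hφ, hψ]⟩

theorem FO.or (hP : FO P) (hQ : FO Q) : FO fun v => P v ∨ Q v := by
  obtain ⟨φ, hφ⟩ := hP
  obtain ⟨ψ, hψ⟩ := hQ
  exact ⟨φ ⊔ ψ, fun v => by rw [Formula.realize_sup, hφ, hψ]⟩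

theorem FO.iff (hP : FO P) (hQ : FO Q) : FO fun v => P v ↔ Q v := by
  obtain ⟨φ, hφ⟩ := hP
  obtain ⟨ψ, hψ⟩ := hQ
  exact ⟨φ.iff ψ, fun v => by rw [Formula.realize_iff, hφ, hψ]⟩

theorem FO.relabel {β : Type} {R : (β → Rk lam) → Prop} (hR : FO R) (g : β → α) :
    FO fun v : α → Rk lam => R (v ∘ g) := by
  obtain ⟨φ, hφ⟩ := hR
  exact ⟨Formula.relabel g φ, fun v => by rw [Formula.realize_relabel, hφ]⟩

theorem FO.alls {β : Type} [Finite β] {R : (α → Rk lam) → (β → Rk lam) → Prop}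
    (h : FO fun w : α ⊕ β → Rk lam => R (w ∘ Sum.inl) (w ∘ Sum.inr)) :
    FO fun v => ∀ x, R v x := by
  obtain ⟨φ, hφ⟩ := h
  refine ⟨Formula.iAlls β φ, fun v => ?_⟩
  rw [Formula.realize_iAlls]
  exact forall_congr' fun x => hφ _

theorem FO.all {R : (α → Rk lam) → Rk lam → Prop}
    (h : FO fun w : α ⊕ Unit → Rk lam => R (w ∘ Sum.inl) (w (Sum.inr ()))) :
    FO fun v => ∀ x, R v x := by
  obtain ⟨φ, hφ⟩ := FO.alls (β := Unit) (R := fun v x => R v (x ())) h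
  exact ⟨φ, fun v => (hφ v).trans ⟨fun H x => H fun _ => x, fun H x => H (x ())⟩⟩

theorem FO.ex {R : (α → Rk lam) → Rk lam → Prop}
    (h : FO fun w : α ⊕ Unit → Rk lam => R (w ∘ Sum.inl) (w (Sum.inr ()))) :
    FO fun v => ∃ x, R v x := by
  obtain ⟨φ, hφ⟩ := (FO.all (R := fun v x => ¬ R v x) h.not).not
  exact ⟨φ, fun v => (hφ v).trans (by push Not; rfl)⟩

theorem FO.finAll {n : ℕ} {R : Fin n → (α → Rk lam) → Prop} (h : ∀ i, FO (R i)) :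
    FO fun v => ∀ i, R i v := by
  choose φ hφ using h
  refine ⟨Formula.iInf φ, fun v => ?_⟩
  rw [Formula.realize_iInf]
  exact forall_congr' fun i => hφ i v

end FO

/-! ### Elementary facts about `V_lam` -/

section Basic

variable {lam : Ordinal.{u}}

theorem Rk.mem_trans {x : ZFSet.{u}} {y : Rk lam} (h : x ∈ y.1) : x ∈ V_ lam :=
  isTransitive_vonNeumann lam _ y.2 h

theorem Rk.ext {x y : Rk lam} (h : ∀ z : Rk lam, z.1 ∈ x.1 ↔ z.1 ∈ y.1) : x = y := by
  refine Subtype.ext (ZFSet.ext fun z => ⟨fun hz => ?_, fun hz => ?_⟩)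
  · exact (h ⟨z, Rk.mem_trans hz⟩).1 hz
  · exact (h ⟨z, Rk.mem_trans hz⟩).2 hz

theorem Emb.mem_iff (e : Emb lam) (x y : Rk lam) : (e x).1 ∈ (e y).1 ↔ x.1 ∈ y.1 :=
  (FO.mem (lam := lam) (α := Fin 2) 0 1).map e ![x, y]

theorem vonNeumann_mem {a : Ordinal.{u}} (ha : a < lam) : V_ a ∈ V_ lam :=
  vonNeumann_mem_of_lt ha

/-- `V_a` as an element of `V_lam`, for `a < lam`. -/
noncomputable def Rk.level (a : Set.Iio lam) : Rk lam := ⟨V_ a.1, vonNeumann_mem a.2⟩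

theorem Rk.subset_iff (x y : Rk lam) : x.1 ⊆ y.1 ↔ ∀ z : Rk lam, z.1 ∈ x.1 → z.1 ∈ y.1 :=
  ⟨fun h _ hz => h hz, fun h z hz => h ⟨z, Rk.mem_trans hz⟩ hz⟩

theorem FO.subset {α : Type} (s t : α) : FO fun v : α → Rk lam => (v s).1 ⊆ (v t).1 := by
  simp only [Rk.subset_iff]
  exact FO.all ((FO.mem (Sum.inr ()) (Sum.inl s)).imp (FO.mem (Sum.inr ()) (Sum.inl t)))

theorem Emb.subset_iff (e : Emb lam) (x y : Rk lam) : (e x).1 ⊆ (e y).1 ↔ x.1 ⊆ y.1 :=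
  (FO.subset (lam := lam) (α := Fin 2) 0 1).map e ![x, y]

theorem Emb.level_subset (e : Emb lam) (a : Set.Iio lam) :
    (Rk.level a).1 ⊆ (e (Rk.level a)).1 := by
  obtain ⟨a, ha⟩ := a
  induction a using WellFoundedLT.induction with
  | ind a ih =>
    intro y hy
    obtain ⟨b, hb, hyb⟩ := mem_vonNeumann'.1 hy
    have hb' : b < lam := hb.trans ha
    have key : FO fun v : Fin 2 → Rk lam => ∀ z : Rk lam, z.1 ⊆ (v 0).1 → z.1 ∈ (v 1).1 :=
      FO.all ((FO.subset (Sum.inr ()) (Sum.inl 0)).imp (FO.mem (Sum.inr ()) (Sum.inl 1)))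
    have h1 := (key.map e ![Rk.level ⟨b, hb'⟩, Rk.level ⟨a, ha⟩]).2
      (fun z hz => mem_vonNeumann'.2 ⟨b, hb, hz⟩)
    exact h1 ⟨y, Rk.mem_trans (y := Rk.level ⟨a, ha⟩) hy⟩ (hyb.trans (ih b hb hb'))

theorem pair_mem (hlam : IsSuccLimit lam) {x y : ZFSet.{u}} (hx : x ∈ V_ lam) (hy : y ∈ V_ lam) :
    pair x y ∈ V_ lam := by
  rw [mem_vonNeumann] at *
  rw [pair, rank_pair, rank_singleton, rank_pair]
  exact max_lt (hlam.succ_lt (hlam.succ_lt hx))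
    (hlam.succ_lt (max_lt (hlam.succ_lt hx) (hlam.succ_lt hy)))

theorem isPair_iff (hlam : IsSuccLimit lam) (p x y : Rk lam) :
    p.1 = pair x.1 y.1 ↔ ∀ z : Rk lam, z.1 ∈ p.1 ↔
      ((∀ w : Rk lam, w.1 ∈ z.1 ↔ w = x) ∨ (∀ w : Rk lam, w.1 ∈ z.1 ↔ (w = x ∨ w = y))) := by
  have h1 : ∀ z : Rk lam, z.1 = {x.1} ↔ ∀ w : Rk lam, w.1 ∈ z.1 ↔ w = x := by
    intro z
    refine ⟨fun h w => by rw [h, mem_singleton, Subtype.ext_iff], fun h => ZFSet.ext fun w => ?_⟩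
    rw [mem_singleton]
    refine ⟨fun hw => ?_, fun hw => ?_⟩
    · exact congrArg Subtype.val ((h ⟨w, Rk.mem_trans hw⟩).1 hw)
    · rw [hw]; exact (h x).2 rfl
  have h2 : ∀ z : Rk lam, z.1 = {x.1, y.1} ↔ ∀ w : Rk lam, w.1 ∈ z.1 ↔ (w = x ∨ w = y) := by
    intro z
    refine ⟨fun h w => by rw [h, mem_pair, Subtype.ext_iff, Subtype.ext_iff],
      fun h => ZFSet.ext fun w => ?_⟩
    rw [mem_pair]
    refine ⟨fun hw => ?_, fun hw => ?_⟩
    · exact ((h ⟨w, Rk.mem_trans hw⟩).1 hw).imp (congrArg Subtype.val) (congrArg Subtype.val)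
    · rcases hw with hw | hw
      · rw [hw]; exact (h x).2 (Or.inl rfl)
      · rw [hw]; exact (h y).2 (Or.inr rfl)
  simp only [← h1, ← h2]
  refine ⟨fun h z => by rw [h, pair, mem_pair], fun h => ZFSet.ext fun z => ?_⟩
  refine ⟨fun hz => ?_, fun hz => ?_⟩
  · rw [pair, mem_pair]
    exact (h ⟨z, Rk.mem_trans hz⟩).1 hz
  · have hz' : z ∈ V_ lam :=
      Rk.mem_trans (y := ⟨pair x.1 y.1, pair_mem hlam x.2 y.2⟩) hz
    rw [pair, mem_pair] at hz
    exact (h ⟨z, hz'⟩).2 hz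

theorem FO.isPair (hlam : IsSuccLimit lam) {α : Type} (p x y : α) :
    FO fun v : α → Rk lam => (v p).1 = pair (v x).1 (v y).1 := by
  simp only [isPair_iff hlam]
  refine FO.all ((FO.mem (Sum.inr ()) (Sum.inl p)).iff (FO.or (FO.all ?_) (FO.all ?_)))
  · exact (FO.mem (Sum.inr ()) (Sum.inl (Sum.inr ()))).iff
      (FO.eq (Sum.inr ()) (Sum.inl (Sum.inl x)))
  · exact (FO.mem (Sum.inr ()) (Sum.inl (Sum.inr ()))).iff
      ((FO.eq (Sum.inr ()) (Sum.inl (Sum.inl x))).or (FO.eq (Sum.inr ()) (Sum.inl (Sum.inl y))))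

theorem FO.pairMem (hlam : IsSuccLimit lam) {α : Type} (x y f : α) :
    FO fun v : α → Rk lam => pair (v x).1 (v y).1 ∈ (v f).1 := by
  have h : FO fun v : α → Rk lam => ∃ p : Rk lam, p.1 = pair (v x).1 (v y).1 ∧ p.1 ∈ (v f).1 :=
    FO.ex ((FO.isPair hlam (Sum.inr ()) (Sum.inl x) (Sum.inl y)).and
      (FO.mem (Sum.inr ()) (Sum.inl f)))
  obtain ⟨φ, hφ⟩ := h
  refine ⟨φ, fun v => (hφ v).trans ⟨?_, fun h => ⟨⟨_, Rk.mem_trans h⟩, rfl, h⟩⟩⟩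
  rintro ⟨p, hp, hpf⟩
  exact hp ▸ hpf

/-! ### Application of one embedding to another -/

/-- The restriction `k ↾ V_a = {(x, k x) : x ∈ V_a}`, as a set. -/
noncomputable def restrictSet (k : Emb lam) (a : Set.Iio lam) : ZFSet.{u} :=
  ZFSet.sep (fun p => ∃ x : Rk lam, x.1 ∈ V_ a.1 ∧ p = pair x.1 (k x).1) (V_ lam)

theorem restrictSet_mem (hlam : IsSuccLimit lam) (k : Emb lam) (a : Set.Iio lam) :
    restrictSet k a ∈ V_ lam := by
  set m : Ordinal.{u} := max a.1 (rank (k (Rk.level a)).1) with hm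
  have hmlt : m < lam := max_lt a.2 (mem_vonNeumann.1 (k (Rk.level a)).2)
  have h3 : succ (succ m) < lam := hlam.succ_lt (hlam.succ_lt hmlt)
  rw [mem_vonNeumann]
  refine lt_of_le_of_lt (rank_le_iff.2 ?_) h3
  intro p hp
  obtain ⟨-, x, hx, rfl⟩ := mem_sep.1 hp
  have hx1 : rank x.1 < m := lt_of_lt_of_le (mem_vonNeumann.1 hx) (le_max_left _ _)
  have hx2 : rank (k x).1 < m :=
    lt_of_lt_of_le (rank_lt_of_mem ((k.mem_iff x (Rk.level a)).2 hx)) (le_max_right _ _)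
  rw [pair, rank_pair, rank_singleton, rank_pair]
  refine max_lt (succ_lt_succ (lt_of_le_of_lt (succ_le_of_lt hx1) (lt_succ m)))
    (succ_lt_succ (max_lt ?_ ?_))
  · exact lt_of_le_of_lt (succ_le_of_lt hx1) (lt_succ m)
  · exact lt_of_le_of_lt (succ_le_of_lt hx2) (lt_succ m)

/-- The restriction `k ↾ V_a`, as an element of `V_lam`. -/
noncomputable def restrict (hlam : IsSuccLimit lam) (k : Emb lam) (a : Set.Iio lam) : Rk lam :=
  ⟨restrictSet k a, restrictSet_mem hlam k a⟩

theorem mem_restrict (hlam : IsSuccLimit lam) (k : Emb lam) (a : Set.Iio lam) (p : ZFSet.{u}) :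
    p ∈ (restrict hlam k a).1 ↔
      p ∈ V_ lam ∧ ∃ x : Rk lam, x.1 ∈ V_ a.1 ∧ p = pair x.1 (k x).1 := by
  change p ∈ restrictSet k a ↔ _
  unfold restrictSet
  exact mem_sep

theorem pair_mem_restrict (hlam : IsSuccLimit lam) (k : Emb lam) (a : Set.Iio lam)
    (x y : Rk lam) : pair x.1 y.1 ∈ (restrict hlam k a).1 ↔ x.1 ∈ V_ a.1 ∧ k x = y := by
  refine (mem_restrict hlam k a _).trans ⟨?_, ?_⟩
  · rintro ⟨-, z, hz, h⟩
    obtain ⟨h1, h2⟩ := pair_inj.1 h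
    have : x = z := Subtype.ext h1
    subst this
    exact ⟨hz, Subtype.ext h2.symm⟩
  · rintro ⟨hx, rfl⟩
    exact ⟨pair_mem hlam x.2 (k x).2, x, hx, rfl⟩

/-- `(x, y)` belongs to `e(k) = ⋃_{a < lam} e(k ↾ V_a)`. -/
def AppRel (hlam : IsSuccLimit lam) (e k : Emb lam) (x y : Rk lam) : Prop :=
  ∃ a : Set.Iio lam, pair x.1 y.1 ∈ (e (restrict hlam k a)).1

theorem restrict_mono (hlam : IsSuccLimit lam) (k : Emb lam) {a b : Set.Iio lam} (h : a ≤ b) :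
    (restrict hlam k a).1 ⊆ (restrict hlam k b).1 := by
  intro p hp
  obtain ⟨h1, x, hx, rfl⟩ := (mem_restrict hlam k a _).1 hp
  exact (mem_restrict hlam k b _).2 ⟨h1, x, vonNeumann_subset_of_le h hx, rfl⟩

theorem appRel_exists (hlam : IsSuccLimit lam) (e k : Emb lam) (x : Rk lam) :
    ∃ y, AppRel hlam e k x y := by
  have ha : succ (rank x.1) < lam := hlam.succ_lt (mem_vonNeumann.1 x.2)
  have key : FO fun v : Fin 2 → Rk lam =>
      ∀ z : Rk lam, z.1 ∈ (v 0).1 → ∃ y : Rk lam, pair z.1 y.1 ∈ (v 1).1 :=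
    FO.all ((FO.mem (Sum.inr ()) (Sum.inl 0)).imp
      (FO.ex (FO.pairMem hlam (Sum.inl (Sum.inr ())) (Sum.inr ()) (Sum.inl (Sum.inl 1)))))
  have h1 := (key.map e ![Rk.level ⟨_, ha⟩, restrict hlam k ⟨_, ha⟩]).2
    (fun z hz => ⟨k z, (pair_mem_restrict hlam k _ z _).2 ⟨hz, rfl⟩⟩)
  obtain ⟨y, hy⟩ := h1 x (e.level_subset ⟨_, ha⟩ (mem_vonNeumann_succ x.1))
  exact ⟨y, _, hy⟩

/-- If tuples `x`, `y` are related entrywise by `e(k)`, they satisfy the same formulas. -/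
theorem appRel_elementary (hlam : IsSuccLimit lam) (e k : Emb lam) {n : ℕ}
    (φ : LSet.Formula (Fin n)) (x y : Fin n → Rk lam) (h : ∀ i, AppRel hlam e k (x i) (y i)) :
    φ.Realize y ↔ φ.Realize x := by
  choose a ha using h
  obtain ⟨b, hb⟩ : ∃ b : Set.Iio lam, ∀ i, a i ≤ b := by
    have : Nonempty (Set.Iio lam) := ⟨⟨⊥, hlam.bot_lt⟩⟩
    exact (Set.finite_range a).bddAbove.imp fun b hb i => hb ⟨i, rfl⟩
  have hb' : ∀ i, pair (x i).1 (y i).1 ∈ (e (restrict hlam k b)).1 :=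
    fun i => (e.subset_iff _ _).2 (restrict_mono hlam k (hb i)) (ha i)
  have key : FO fun v : Unit → Rk lam => ∀ w : Fin n ⊕ Fin n → Rk lam,
      (∀ i, pair (w (Sum.inl i)).1 (w (Sum.inr i)).1 ∈ (v ()).1) →
        (φ.Realize (w ∘ Sum.inr) ↔ φ.Realize (w ∘ Sum.inl)) := by
    have hφ : FO fun v : Fin n → Rk lam => φ.Realize v := ⟨φ, fun _ => Iff.rfl⟩
    refine FO.alls (FO.imp (FO.finAll fun i => ?_) (FO.iff ?_ ?_))
    · exact FO.pairMem hlam (Sum.inr (Sum.inl i)) (Sum.inr (Sum.inr i)) (Sum.inl ())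
    · exact hφ.relabel fun i => Sum.inr (Sum.inr i)
    · exact hφ.relabel fun i => Sum.inr (Sum.inl i)
  have h1 := (key.map e fun _ => restrict hlam k b).2 (by
    intro w hw
    have : w ∘ Sum.inr = k ∘ (w ∘ Sum.inl) :=
      funext fun i => ((pair_mem_restrict hlam k b _ _).1 (hw i)).2.symm
    rw [this, k.map_formula])
  exact h1 (Sum.elim x y) hb'

/-- Application: `e(k) = ⋃_{a < lam} e(k ↾ V_a)`, again an elementary embedding of `V_lam` into
itself. -/
noncomputable def app (hlam : IsSuccLimit lam) (e k : Emb lam) : Emb lam where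
  toFun x := (appRel_exists hlam e k x).choose
  map_formula' _ φ x :=
    appRel_elementary hlam e k φ x _ fun i => (appRel_exists hlam e k (x i)).choose_spec

/-- The graph of `e(k)` is exactly `⋃_{a < lam} e(k ↾ V_a)`. -/
theorem app_eq_iff (hlam : IsSuccLimit lam) (e k : Emb lam) (x y : Rk lam) :
    app hlam e k x = y ↔
      ∃ a : Set.Iio lam, pair x.1 y.1 ∈ (e (restrict hlam k a)).1 := by
  have hs : AppRel hlam e k x (app hlam e k x) := (appRel_exists hlam e k x).choose_spec
  refine ⟨fun h => h ▸ hs, fun h => ?_⟩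
  have := appRel_elementary hlam e k (n := 2) (Term.equal (Term.var 0) (Term.var 1))
    ![x, x] ![app hlam e k x, y] (by
      intro i
      fin_cases i
      · exact hs
      · exact h)
  simpa [Formula.realize_equal] using this

/-! ### Action on ordinals, critical points -/

/-- The von Neumann ordinal `a < lam`, as an element of `V_lam`. -/
noncomputable def Rk.ofOrd (a : Set.Iio lam) : Rk lam :=
  ⟨a.1.toZFSet, mem_vonNeumann.2 (by rw [rank_toZFSet]; exact a.2)⟩

/-- The action of an embedding on the ordinals below `lam`; see `Emb.apply_ofOrd`. -/
noncomputable def Emb.ord (e : Emb lam) (a : Set.Iio lam) : Set.Iio lam :=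
  ⟨rank (e (Rk.ofOrd a)).1, mem_vonNeumann.1 (e (Rk.ofOrd a)).2⟩

theorem FO.isOrdinal {α : Type} (s : α) : FO fun v : α → Rk lam => (v s).1.IsOrdinal := by
  have h : ∀ x : Rk lam, x.1.IsOrdinal ↔
      (∀ y : Rk lam, y.1 ∈ x.1 → y.1 ⊆ x.1) ∧
        ∀ y : Rk lam, y.1 ∈ x.1 → ∀ z : Rk lam, z.1 ∈ y.1 → z.1 ⊆ y.1 := by
    intro x
    rw [isOrdinal_iff_forall_mem_isTransitive]
    refine ⟨fun ⟨h1, h2⟩ => ⟨fun y hy => h1 _ hy, fun y hy z hz => h2 _ hy _ hz⟩,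
      fun ⟨h1, h2⟩ => ⟨fun y hy => h1 ⟨y, Rk.mem_trans hy⟩ hy, fun y hy z hz => ?_⟩⟩
    have hy' : y ∈ V_ lam := Rk.mem_trans hy
    exact h2 ⟨y, hy'⟩ hy ⟨z, Rk.mem_trans (y := ⟨y, hy'⟩) hz⟩ hz
  simp only [h]
  refine FO.and (FO.all ((FO.mem (Sum.inr ()) (Sum.inl s)).imp ?_))
    (FO.all ((FO.mem (Sum.inr ()) (Sum.inl s)).imp (FO.all (FO.imp ?_ ?_))))
  · exact FO.subset (Sum.inr ()) (Sum.inl s)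
  · exact FO.mem (Sum.inr ()) (Sum.inl (Sum.inr ()))
  · exact FO.subset (Sum.inr ()) (Sum.inl (Sum.inr ()))

/-- `e` sends the von Neumann ordinal `a` to the von Neumann ordinal `e.ord a`. -/
theorem Emb.apply_ofOrd (e : Emb lam) (a : Set.Iio lam) :
    e (Rk.ofOrd a) = Rk.ofOrd (e.ord a) := by
  have h : (e (Rk.ofOrd a)).1.IsOrdinal :=
    ((FO.isOrdinal (lam := lam) ()).map e fun _ => Rk.ofOrd a).2 (isOrdinal_toZFSet a.1)
  exact Subtype.ext h.toZFSet_rank_eq.symm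

/-- `a` is the critical point of `e`: the least ordinal that `e` moves. -/
def IsCrit (e : Emb lam) (a : Set.Iio lam) : Prop := IsLeast {b | e.ord b ≠ b} a

theorem Emb.level_apply (hlam : IsSuccLimit lam) (e : Emb lam) (a : Set.Iio lam) :
    e (Rk.level a) = Rk.level (e.ord a) := by
  let S : ZFSet.{u} := ZFSet.sep (fun x => ∃ b ≤ a.1, x = V_ b) (V_ lam)
  have hSm : ∀ {x : ZFSet.{u}}, x ∈ S ↔ x ∈ V_ lam ∧ ∃ b ≤ a.1, x = V_ b := mem_sep
  have hS : S ∈ V_ lam := by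
    rw [mem_vonNeumann]
    refine lt_of_le_of_lt (rank_le_iff.2 ?_) (hlam.succ_lt a.2)
    intro x hx
    obtain ⟨-, b, hb, rfl⟩ := mem_sep.1 hx
    rw [rank_vonNeumann]
    exact lt_succ_of_le hb
  have key : FO fun v : Unit → Rk lam => ∀ y : Rk lam, y.1 ∈ (v ()).1 →
      ∀ x : Rk lam, x.1 ∈ y.1 ↔ ∃ z : Rk lam, z.1 ∈ (v ()).1 ∧ (z.1 ∈ y.1 ∧ x.1 ⊆ z.1) := by
    refine FO.all (FO.imp (FO.mem (Sum.inr ()) (Sum.inl ())) (FO.all (FO.iff ?_ (FO.ex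
      (FO.and ?_ (FO.and ?_ ?_))))))
    · exact FO.mem (Sum.inr ()) (Sum.inl (Sum.inr ()))
    · exact FO.mem (Sum.inr ()) (Sum.inl (Sum.inl (Sum.inl ())))
    · exact FO.mem (Sum.inr ()) (Sum.inl (Sum.inl (Sum.inr ())))
    · exact FO.subset (Sum.inl (Sum.inr ())) (Sum.inr ())
  have h1 := (key.map e fun _ => ⟨S, hS⟩).2 (by
    intro y hy x
    obtain ⟨-, b, hb, hyb⟩ := hSm.1 hy
    rw [hyb, mem_vonNeumann']
    constructor
    · rintro ⟨c, hc, hxc⟩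
      have hcl : c < lam := (hc.trans_le hb).trans a.2
      exact ⟨⟨V_ c, vonNeumann_mem hcl⟩, hSm.2 ⟨vonNeumann_mem hcl, c, hc.le.trans hb, rfl⟩,
        vonNeumann_mem_of_lt hc, hxc⟩
    · rintro ⟨z, hz, hzb, hxz⟩
      obtain ⟨-, c, -, hzc⟩ := hSm.1 hz
      rw [hzc] at hzb hxz
      exact ⟨c, vonNeumann_mem_vonNeumann_iff.1 hzb, hxz⟩)
  have h2 : ∀ y : ZFSet.{u}, y ∈ (e ⟨S, hS⟩).1 → y = V_ (rank y) := by
    intro y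
    induction y using ZFSet.inductionOn with
    | h y ih =>
      intro hy
      have hyl : y ∈ V_ lam := Rk.mem_trans hy
      refine ZFSet.ext fun x => ⟨fun hx => mem_vonNeumann.2 (rank_lt_of_mem hx), fun hx => ?_⟩
      obtain ⟨t, ht, hxt⟩ := lt_rank_iff.1 (mem_vonNeumann.1 hx)
      have htl : t ∈ V_ lam := Rk.mem_trans (y := ⟨y, hyl⟩) ht
      obtain ⟨z, hz, hzy, htz⟩ := (h1 ⟨y, hyl⟩ hy ⟨t, htl⟩).1 ht
      have hxz : x ⊆ z.1 := by
        rw [ih z.1 hzy hz, subset_vonNeumann]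
        exact hxt.trans (rank_mono htz)
      have hxl : x ∈ V_ lam := mem_vonNeumann_of_subset hxz z.2
      exact (h1 ⟨y, hyl⟩ hy ⟨x, hxl⟩).2 ⟨z, hz, hzy, hxz⟩
  have h3 := h2 (e (Rk.level a)).1 ((e.mem_iff _ ⟨S, hS⟩).2
    (hSm.2 ⟨vonNeumann_mem a.2, a.1, le_rfl, rfl⟩))
  have h4 : (e (Rk.ofOrd a)).1 ⊆ (e (Rk.level a)).1 :=
    (e.subset_iff _ _).2 a.1.toZFSet_subset_vonNeumann
  have h5 : ¬ (e (Rk.ofOrd a)).1 ∈ (e (Rk.level a)).1 := by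
    rw [e.mem_iff]
    intro h
    have := mem_vonNeumann.1 h
    rw [show (Rk.ofOrd a).1 = a.1.toZFSet from rfl, rank_toZFSet] at this
    exact lt_irrefl _ this
  rw [h3, subset_vonNeumann] at h4
  rw [h3, mem_vonNeumann, not_lt] at h5
  refine Subtype.ext (h3.trans ?_)
  rw [le_antisymm h5 h4]
  rfl

/-- An embedding other than the identity moves an ordinal. -/
theorem exists_moved (hlam : IsSuccLimit lam) (e : Emb lam) (he : e ≠ Emb.id lam) :
    {b : Set.Iio lam | e.ord b ≠ b}.Nonempty := by
  by_contra hcon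
  have hfix : ∀ b, e.ord b = b := by
    intro b
    by_contra hb
    exact hcon ⟨b, hb⟩
  apply he
  have main : ∀ x : ZFSet.{u}, ∀ hx : x ∈ V_ lam, e ⟨x, hx⟩ = ⟨x, hx⟩ := by
    intro x
    induction h : rank x using WellFoundedLT.induction generalizing x with
    | ind r ih =>
      intro hx
      refine Rk.ext fun z => ⟨fun hz => ?_, fun hz => ?_⟩
      · have hr : r < lam := h ▸ mem_vonNeumann.1 hx
        have h1 : (e ⟨x, hx⟩).1 ⊆ (e (Rk.level ⟨r, hr⟩)).1 :=
          (e.subset_iff _ _).2 (subset_vonNeumann.2 h.le)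
        rw [e.level_apply hlam, hfix] at h1
        have h2 := ih _ (mem_vonNeumann.1 (h1 hz)) z.1 rfl z.2
        rw [show (⟨x, hx⟩ : Rk lam).1 = x from rfl]
        rw [← show e z = z from h2] at hz
        exact (e.mem_iff _ _).1 hz
      · have h2 := ih _ (h ▸ rank_lt_of_mem hz) z.1 rfl z.2
        have h3 := (e.mem_iff z ⟨x, hx⟩).2 hz
        rwa [show e z = z from h2] at h3
  exact DFunLike.ext _ _ fun x => main x.1 x.2

/-- The critical point of a nonidentity embedding. -/
noncomputable def crit (hlam : IsSuccLimit lam) (e : Emb lam) (he : e ≠ Emb.id lam) :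
    Set.Iio lam :=
  wellFounded_lt.min {b : Set.Iio lam | e.ord b ≠ b} (exists_moved hlam e he)

theorem isCrit_crit (hlam : IsSuccLimit lam) (e : Emb lam) (he : e ≠ Emb.id lam) :
    IsCrit e (crit hlam e he) :=
  ⟨wellFounded_lt.min_mem _ _, fun _ hb => not_lt.1 (wellFounded_lt.not_lt_min _ hb)⟩

/-- The critical sequence of `j`: `κ_0 = crit j` and `κ_{i+1} = j(κ_i)`. -/
noncomputable def kappa (hlam : IsSuccLimit lam) (j : Emb lam) (hj : j ≠ Emb.id lam) :
    ℕ → Set.Iio lam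
  | 0 => crit hlam j hj
  | i + 1 => j.ord (kappa hlam j hj i)

/-- The left powers `j_(1) = j`, `j_(n+1) = j_(n)(j)`. The index `0` is not used. -/
noncomputable def jsub (hlam : IsSuccLimit lam) (j : Emb lam) : ℕ → Emb lam
  | 0 => j
  | 1 => j
  | n + 2 => app hlam (jsub hlam j (n + 1)) j

/-- The critical sequence of `e` begins with the listed ordinals: the first one is the critical
point of `e`, and `e` sends each listed ordinal to the next one. -/
def CritSeqBegins (e : Emb lam) : List (Set.Iio lam) → Prop
  | [] => True
  | a :: l => IsCrit e a ∧ List.IsChain (fun x y => e.ord x = y) (a :: l)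

end Basic

end RankEmb

/-!
The proof rests on three laws for `e(k)`: it sends `e(a)` to `e(k(a))` (`app_ord`), its critical
point is `e(crit k)` (`IsCrit.app`), and application is left distributive (`app_app`).

Since `j_(n+1) = j_(n)(j)`, the first two laws say that the critical sequence of `j_(n+1)` is the
image under `j_(n)` of that of `j`. Row `n + 1` of the table is therefore read off from row `n`,
provided the values of `j_(n)` at `κ_0, …, κ_4` are known. Below its critical point `j_(n)` is the
identity, and the remaining values are entries of row `n`. Final values above `κ_4` come from
`j_(n)(κ_4) > κ_4`, which passes from `n` to `n + 1` because a critical sequence that starts at or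
below `κ_4` and ends above it must cross `κ_4` (`Emb.lt_ord_of_iterate`).

Only `j_(7)(κ_1) = κ_3` and `j_(11)(κ_1) = κ_3` are not of this kind. They use agreement of
embeddings up to a rank: `e(k)` agrees with `k` up to `crit e` (`IsCrit.agree_app`), and agreement
is inherited by both arguments of application (`Agree.app_right`, `Agree.app_left`). With `e = j_(4)`
or `e = j_(8)`, the embedding `e(j)` agrees with `j` up to `crit e`, so that by left distributivity
`e(j_(3)) = (e(j)(e(j)))(e(j))` agrees with `(e(j)(j))(j)`, which is `j_(7)` or `j_(11)`, up to a
bound beyond the value in question (`IsCrit.app_ord_eq`). As `κ_1 < crit e`, the value of `e(j_(3))`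
at `κ_1` is `e(j_(3)(κ_1)) = e(κ_{2.5}) = κ_3`.
-/

namespace RankEmb

open FirstOrder FirstOrder.Language ZFSet Order Ordinal

section Embeddings

variable {lam : Ordinal.{u}}

/-! ### Order properties of the action on ordinals -/

theorem Rk.ofOrd_mem_iff (a b : Set.Iio lam) : (Rk.ofOrd a).1 ∈ (Rk.ofOrd b).1 ↔ a < b := by
  change a.1.toZFSet ∈ b.1.toZFSet ↔ a.1 < b.1
  exact toZFSet_mem_toZFSet_iff

theorem Rk.mem_ofOrd {x : Rk lam} {b : Set.Iio lam} (h : x.1 ∈ (Rk.ofOrd b).1) :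
    ∃ a < b, x = Rk.ofOrd a := by
  obtain ⟨a, ha, hx⟩ := mem_toZFSet_iff.1 (show x.1 ∈ b.1.toZFSet from h)
  exact ⟨⟨a, ha.trans b.2⟩, ha, Subtype.ext hx.symm⟩

theorem Emb.ord_strictMono (e : Emb lam) : StrictMono e.ord := by
  intro a b h
  rw [← Rk.ofOrd_mem_iff, ← e.apply_ofOrd, ← e.apply_ofOrd, e.mem_iff, Rk.ofOrd_mem_iff]
  exact h

theorem Emb.le_ord (e : Emb lam) (a : Set.Iio lam) : a ≤ e.ord a :=
  e.ord_strictMono.le_apply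

theorem Rk.ofOrd_injective : Function.Injective (Rk.ofOrd (lam := lam)) := by
  intro a b h
  have h' := congrArg (fun x : Rk lam => rank x.1) h
  simpa [Rk.ofOrd, rank_toZFSet, Subtype.ext_iff] using h'

theorem IsCrit.ord_eq {e : Emb lam} {c a : Set.Iio lam} (hc : IsCrit e c) (h : a < c) :
    e.ord a = a := by
  by_contra ha
  exact absurd (hc.2 ha) (not_le.2 h)

theorem IsCrit.lt_ord {e : Emb lam} {c : Set.Iio lam} (hc : IsCrit e c) : c < e.ord c :=
  lt_of_le_of_ne (e.le_ord c) (Ne.symm hc.1)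

/-- An embedding fixes every set of rank below its critical point. -/
theorem IsCrit.apply_eq (hlam : IsSuccLimit lam) {e : Emb lam} {c : Set.Iio lam}
    (hc : IsCrit e c) (x : Rk lam) (hx : x.1 ∈ V_ c.1) : e x = x := by
  obtain ⟨x, hxl⟩ := x
  induction h : rank x using WellFoundedLT.induction generalizing x with
  | ind r ih =>
    have hrc : r < c.1 := h ▸ mem_vonNeumann.1 hx
    refine Rk.ext fun z => ⟨fun hz => ?_, fun hz => ?_⟩
    · have hr : r < lam := hrc.trans c.2
      have h1 : (e ⟨x, hxl⟩).1 ⊆ (e (Rk.level ⟨r, hr⟩)).1 :=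
        (e.subset_iff _ _).2 (subset_vonNeumann.2 h.le)
      rw [e.level_apply hlam, hc.ord_eq (a := ⟨r, hr⟩) hrc] at h1
      have hzr := mem_vonNeumann.1 (h1 hz)
      have h2 := ih _ hzr z.1 z.2 (mem_vonNeumann.2 (hzr.trans hrc)) rfl
      rw [← show e z = z from h2] at hz
      exact (e.mem_iff _ _).1 hz
    · have hzr : rank z.1 < r := h ▸ rank_lt_of_mem hz
      have h2 := ih _ hzr z.1 z.2 (mem_vonNeumann.2 (hzr.trans hrc)) rfl
      have h3 := (e.mem_iff z ⟨x, hxl⟩).2 hz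
      rwa [show e z = z from h2] at h3

/-- Density of the order below `a`, in a form that also holds for `a = 0`: no ordinal below `a`
is the largest one. -/
def NoMaxBelow (a : Set.Iio lam) : Prop := ∀ b < a, ∃ d < a, b < d

theorem NoMaxBelow.ord {a : Set.Iio lam} (h : NoMaxBelow a) (e : Emb lam) :
    NoMaxBelow (e.ord a) := by
  have key : FO fun v : Unit → Rk lam => ∀ y : Rk lam, y.1 ∈ (v ()).1 →
      ∃ z : Rk lam, z.1 ∈ (v ()).1 ∧ y.1 ∈ z.1 :=
    FO.all ((FO.mem (Sum.inr ()) (Sum.inl ())).imp (FO.ex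
      ((FO.mem (Sum.inr ()) (Sum.inl (Sum.inl ()))).and
        (FO.mem (Sum.inl (Sum.inr ())) (Sum.inr ())))))
  have h1 := (key.map e fun _ => Rk.ofOrd a).2 (by
    intro y hy
    obtain ⟨b, hb, rfl⟩ := Rk.mem_ofOrd hy
    obtain ⟨d, hd, hbd⟩ := h b hb
    exact ⟨Rk.ofOrd d, (Rk.ofOrd_mem_iff _ _).2 hd, (Rk.ofOrd_mem_iff _ _).2 hbd⟩)
  simp only [Function.comp_apply, e.apply_ofOrd] at h1
  intro b hb
  obtain ⟨z, hz, hbz⟩ := h1 (Rk.ofOrd b) ((Rk.ofOrd_mem_iff _ _).2 hb)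
  obtain ⟨d, hd, rfl⟩ := Rk.mem_ofOrd hz
  exact ⟨d, hd, (Rk.ofOrd_mem_iff _ _).1 hbz⟩

theorem IsCrit.noMaxBelow {e : Emb lam} {c : Set.Iio lam} (hc : IsCrit e c) : NoMaxBelow c := by
  intro b hb
  by_contra! hcon
  have key : FO fun v : Fin 2 → Rk lam => ∀ y : Rk lam, y.1 ∈ (v 0).1 → ¬ (v 1).1 ∈ y.1 :=
    FO.all ((FO.mem (Sum.inr ()) (Sum.inl 0)).imp (FO.mem (Sum.inl 1) (Sum.inr ())).not)
  have h1 := (key.map e ![Rk.ofOrd c, Rk.ofOrd b]).2 (by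
    intro y hy
    obtain ⟨d, hd, rfl⟩ := Rk.mem_ofOrd hy
    exact fun h => absurd ((Rk.ofOrd_mem_iff _ _).1 h) (not_lt.2 (hcon d hd)))
  have h2 : ¬ (e (Rk.ofOrd b)).1 ∈ (Rk.ofOrd c).1 := h1 (Rk.ofOrd c) (by
    change (Rk.ofOrd c).1 ∈ (e (Rk.ofOrd c)).1
    rw [e.apply_ofOrd, Rk.ofOrd_mem_iff]
    exact hc.lt_ord)
  rw [e.apply_ofOrd, hc.ord_eq hb, Rk.ofOrd_mem_iff] at h2
  exact h2 hb

/-! ### The algebra of application -/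

theorem app_apply (hlam : IsSuccLimit lam) (e k : Emb lam) (x : Rk lam) :
    app hlam e k (e x) = e (k x) := by
  have ha : succ (rank x.1) < lam := hlam.succ_lt (mem_vonNeumann.1 x.2)
  refine (app_eq_iff hlam e k _ _).2 ⟨⟨_, ha⟩, ?_⟩
  exact ((FO.pairMem hlam (α := Fin 3) 0 1 2).map e ![x, k x, restrict hlam k ⟨_, ha⟩]).2
    ((pair_mem_restrict hlam k _ _ _).2 ⟨mem_vonNeumann_succ x.1, rfl⟩)

theorem app_ord (hlam : IsSuccLimit lam) (e k : Emb lam) (a : Set.Iio lam) :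
    (app hlam e k).ord (e.ord a) = e.ord (k.ord a) := by
  apply Rk.ofOrd_injective
  rw [← Emb.apply_ofOrd, ← Emb.apply_ofOrd, ← Emb.apply_ofOrd, ← Emb.apply_ofOrd, app_apply]

theorem pair_mem_apply_restrict (hlam : IsSuccLimit lam) (e k : Emb lam) (a : Set.Iio lam)
    (x y : Rk lam) : pair x.1 y.1 ∈ (e (restrict hlam k a)).1 ↔
      x.1 ∈ V_ (e.ord a).1 ∧ app hlam e k x = y := by
  have dom : FO fun v : Fin 2 → Rk lam => ∀ x y : Rk lam, pair x.1 y.1 ∈ (v 0).1 →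
      x.1 ∈ (v 1).1 :=
    FO.all (FO.all ((FO.pairMem hlam (Sum.inl (Sum.inr ())) (Sum.inr ())
      (Sum.inl (Sum.inl 0))).imp (FO.mem (Sum.inl (Sum.inr ())) (Sum.inl (Sum.inl 1)))))
  have tot : FO fun v : Fin 2 → Rk lam => ∀ x : Rk lam, x.1 ∈ (v 1).1 →
      ∃ y : Rk lam, pair x.1 y.1 ∈ (v 0).1 :=
    FO.all ((FO.mem (Sum.inr ()) (Sum.inl 1)).imp
      (FO.ex (FO.pairMem hlam (Sum.inl (Sum.inr ())) (Sum.inr ()) (Sum.inl (Sum.inl 0)))))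
  have h1 := (dom.map e ![restrict hlam k a, Rk.level a]).2
    (fun x y h => ((pair_mem_restrict hlam k a x y).1 h).1)
  have h2 := (tot.map e ![restrict hlam k a, Rk.level a]).2
    (fun x h => ⟨k x, (pair_mem_restrict hlam k a x _).2 ⟨h, rfl⟩⟩)
  simp only [Function.comp_apply, Matrix.cons_val_zero, Matrix.cons_val_one,
    e.level_apply hlam] at h1 h2
  constructor
  · exact fun h => ⟨h1 x y h, (app_eq_iff hlam e k x y).2 ⟨a, h⟩⟩
  · rintro ⟨hx, rfl⟩
    obtain ⟨y, hy⟩ := h2 x hx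
    rwa [(app_eq_iff hlam e k x y).2 ⟨a, hy⟩]

theorem apply_restrict (hlam : IsSuccLimit lam) (e k : Emb lam) (a : Set.Iio lam) :
    e (restrict hlam k a) = restrict hlam (app hlam e k) (e.ord a) := by
  have isPairs : FO fun v : Unit → Rk lam => ∀ p : Rk lam, p.1 ∈ (v ()).1 →
      ∃ x y : Rk lam, p.1 = pair x.1 y.1 :=
    FO.all ((FO.mem (Sum.inr ()) (Sum.inl ())).imp (FO.ex (FO.ex
      (FO.isPair hlam (Sum.inl (Sum.inl (Sum.inr ()))) (Sum.inl (Sum.inr ())) (Sum.inr ())))))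
  have h : ∀ f : Emb lam, ∀ b : Set.Iio lam, ∀ p : Rk lam, p.1 ∈ (restrict hlam f b).1 →
      ∃ x y : Rk lam, p.1 = pair x.1 y.1 := by
    intro f b p hp
    obtain ⟨-, x, -, hx⟩ := (mem_restrict hlam f b _).1 hp
    exact ⟨x, f x, hx⟩
  have h1 := (isPairs.map e fun _ => restrict hlam k a).2 (h k a)
  refine Rk.ext fun p => ⟨fun hp => ?_, fun hp => ?_⟩
  · obtain ⟨x, y, hxy⟩ := h1 p hp
    rw [hxy] at hp ⊢
    rwa [pair_mem_restrict, ← pair_mem_apply_restrict]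
  · obtain ⟨x, y, hxy⟩ := h _ _ p hp
    rw [hxy] at hp ⊢
    rwa [pair_mem_apply_restrict, ← pair_mem_restrict]

/-- Application is left distributive over itself: compare `e(k(l ↾ V_a))` computed in two ways. -/
theorem app_app (hlam : IsSuccLimit lam) (e k l : Emb lam) :
    app hlam e (app hlam k l) = app hlam (app hlam e k) (app hlam e l) := by
  refine DFunLike.ext _ _ fun x => ?_
  set a : Set.Iio lam := ⟨succ (rank x.1), hlam.succ_lt (mem_vonNeumann.1 x.2)⟩ with ha
  have h : restrict hlam (app hlam e (app hlam k l)) (e.ord (k.ord a)) =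
      restrict hlam (app hlam (app hlam e k) (app hlam e l)) (e.ord (k.ord a)) := by
    rw [← apply_restrict, ← apply_restrict, ← app_apply, apply_restrict, apply_restrict, app_ord]
  have hx : x.1 ∈ V_ (e.ord (k.ord a)).1 :=
    vonNeumann_subset_of_le ((k.le_ord a).trans (e.le_ord _)) (mem_vonNeumann_succ x.1)
  have h1 := (pair_mem_restrict hlam (app hlam e (app hlam k l)) _ x _).2 ⟨hx, rfl⟩
  rw [h] at h1
  exact ((pair_mem_restrict hlam _ _ _ _).1 h1).2.symm

theorem IsCrit.app (hlam : IsSuccLimit lam) {k : Emb lam} {c : Set.Iio lam} (hc : IsCrit k c)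
    (e : Emb lam) : IsCrit (app hlam e k) (e.ord c) := by
  constructor
  · change (RankEmb.app hlam e k).ord (e.ord c) ≠ e.ord c
    rw [app_ord]
    exact fun h => hc.1 (e.ord_strictMono.injective h)
  · intro b hb
    by_contra! hlt
    refine hb ?_
    have key : FO fun v : Fin 2 → Rk lam => ∀ x : Rk lam, x.1 ∈ (v 0).1 →
        pair x.1 x.1 ∈ (v 1).1 :=
      FO.all ((FO.mem (Sum.inr ()) (Sum.inl 0)).imp
        (FO.pairMem hlam (Sum.inr ()) (Sum.inr ()) (Sum.inl 1)))
    have h1 := (key.map e ![Rk.ofOrd c, restrict hlam k c]).2 (by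
      intro x hx
      obtain ⟨d, hd, rfl⟩ := Rk.mem_ofOrd hx
      refine (pair_mem_restrict hlam k c _ _).2 ⟨c.1.toZFSet_subset_vonNeumann hx, ?_⟩
      rw [k.apply_ofOrd, hc.ord_eq hd])
    simp only [Function.comp_apply, Matrix.cons_val_zero, Matrix.cons_val_one,
      e.apply_ofOrd] at h1
    have h2 := ((pair_mem_apply_restrict hlam e k c _ _).1
      (h1 (Rk.ofOrd b) ((Rk.ofOrd_mem_iff _ _).2 hlt))).2
    rw [Emb.apply_ofOrd] at h2
    exact Rk.ofOrd_injective h2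

/-! ### Agreement of embeddings up to a rank -/

/-- `k` and `l` agree up to `c`: `k(x) ∩ V_c = l(x) ∩ V_c` for all `x ∈ V_c`. -/
def Agree (c : Set.Iio lam) (k l : Emb lam) : Prop :=
  ∀ x z : Rk lam, x.1 ∈ V_ c.1 → z.1 ∈ V_ c.1 → (z.1 ∈ (k x).1 ↔ z.1 ∈ (l x).1)

theorem Agree.mono {c d : Set.Iio lam} {k l : Emb lam} (h : Agree c k l) (hd : d ≤ c) :
    Agree d k l :=
  fun x z hx hz => h x z (vonNeumann_subset_of_le hd hx) (vonNeumann_subset_of_le hd hz)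

theorem Agree.trans {c : Set.Iio lam} {k l m : Emb lam} (h : Agree c k l) (h' : Agree c l m) :
    Agree c k m :=
  fun x z hx hz => (h x z hx hz).trans (h' x z hx hz)

/-- Embeddings that agree up to `c` take the same values at ordinals below `c`, as long as these
values are below `c`. -/
theorem Agree.ord_eq {c a : Set.Iio lam} {k l : Emb lam} (h : Agree c k l) (ha : a < c)
    (hl : l.ord a < c) : k.ord a = l.ord a := by
  have hV : ∀ b < c, (Rk.ofOrd b).1 ∈ V_ c.1 := fun b hb =>
    mem_vonNeumann.2 (by rw [show (Rk.ofOrd b).1 = b.1.toZFSet from rfl, rank_toZFSet]; exact hb)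
  have key : ∀ b < c, b < k.ord a ↔ b < l.ord a := by
    intro b hb
    have := h (Rk.ofOrd a) (Rk.ofOrd b) (hV a ha) (hV b hb)
    rwa [k.apply_ofOrd, l.apply_ofOrd, Rk.ofOrd_mem_iff, Rk.ofOrd_mem_iff] at this
  have h1 : k.ord a ≤ l.ord a := not_lt.1 fun hlt => lt_irrefl _ ((key _ hl).1 hlt)
  exact le_antisymm h1 (not_lt.1 fun hlt => lt_irrefl _ ((key _ (h1.trans_lt hl)).2 hlt))

theorem IsCrit.agree_app (hlam : IsSuccLimit lam) {e : Emb lam} {c : Set.Iio lam}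
    (hc : IsCrit e c) (k : Emb lam) : Agree c (RankEmb.app hlam e k) k := by
  intro x z hx hz
  have h := app_apply hlam e k x
  rw [hc.apply_eq hlam x hx] at h
  rw [h]
  nth_rewrite 1 [← hc.apply_eq hlam z hz]
  exact e.mem_iff z (k x)

theorem Agree.app_right (hlam : IsSuccLimit lam) {c : Set.Iio lam} {k l : Emb lam}
    (h : Agree c k l) (e : Emb lam) : Agree (e.ord c) (app hlam e k) (app hlam e l) := by
  have key : FO fun v : Fin 3 → Rk lam => ∀ w : Fin 4 → Rk lam,
      (w 1).1 ∈ (v 0).1 → pair (w 0).1 (w 2).1 ∈ (v 1).1 → pair (w 0).1 (w 3).1 ∈ (v 2).1 →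
        ((w 1).1 ∈ (w 2).1 ↔ (w 1).1 ∈ (w 3).1) :=
    FO.alls ((FO.mem (Sum.inr 1) (Sum.inl 0)).imp
      ((FO.pairMem hlam (Sum.inr 0) (Sum.inr 2) (Sum.inl 1)).imp
        ((FO.pairMem hlam (Sum.inr 0) (Sum.inr 3) (Sum.inl 2)).imp
          ((FO.mem (Sum.inr 1) (Sum.inr 2)).iff (FO.mem (Sum.inr 1) (Sum.inr 3))))))
  have h1 := (key.map e ![Rk.level c, restrict hlam k c, restrict hlam l c]).2 (by
    intro w hz hk hl
    obtain ⟨hx, hk⟩ := (pair_mem_restrict hlam k c _ _).1 hk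
    obtain ⟨-, hl⟩ := (pair_mem_restrict hlam l c _ _).1 hl
    rw [← hk, ← hl]
    exact h _ _ hx hz)
  intro x z hx hz
  refine h1 ![x, z, app hlam e k x, app hlam e l x] ?_ ?_ ?_
  · change z.1 ∈ (e (Rk.level c)).1
    rw [e.level_apply hlam]
    exact hz
  · exact (pair_mem_apply_restrict hlam e k c _ _).2 ⟨hx, rfl⟩
  · exact (pair_mem_apply_restrict hlam e l c _ _).2 ⟨hx, rfl⟩

/-- The trace `{(x, z) : x, z ∈ V_d, z ∈ k(x)}` of `k` on `V_d`. Unlike `k ↾ V_d` it has rank at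
most `d + 2` whatever the values of `k` are. -/
noncomputable def traceSet (k : Emb lam) (d : Set.Iio lam) : ZFSet.{u} :=
  ZFSet.sep (fun p => ∃ x z : Rk lam, x.1 ∈ V_ d.1 ∧ z.1 ∈ V_ d.1 ∧ z.1 ∈ (k x).1 ∧
    p = pair x.1 z.1) (V_ lam)

theorem rank_pair_lt {x z : ZFSet.{u}} {d : Ordinal.{u}} (hx : x ∈ V_ d) (hz : z ∈ V_ d) :
    rank (pair x z) < succ (succ d) := by
  rw [mem_vonNeumann] at hx hz
  rw [pair, rank_pair, rank_singleton, rank_pair]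
  exact max_lt (succ_lt_succ (succ_lt_succ hx))
    (succ_lt_succ (max_lt (succ_lt_succ hx) (succ_lt_succ hz)))

theorem rank_traceSet_le (k : Emb lam) (d : Set.Iio lam) :
    rank (traceSet k d) ≤ succ (succ d.1) := by
  refine rank_le_iff.2 fun p hp => ?_
  obtain ⟨-, x, z, hx, hz, -, rfl⟩ := mem_sep.1 hp
  exact rank_pair_lt hx hz

/-- The trace of `k` on `V_d`, as an element of `V_lam`. -/
noncomputable def trace (hlam : IsSuccLimit lam) (k : Emb lam) (d : Set.Iio lam) : Rk lam :=
  ⟨traceSet k d, mem_vonNeumann.2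
    ((rank_traceSet_le k d).trans_lt (hlam.succ_lt (hlam.succ_lt d.2)))⟩

theorem pair_mem_trace (hlam : IsSuccLimit lam) (k : Emb lam) (d : Set.Iio lam) (x z : Rk lam) :
    pair x.1 z.1 ∈ (trace hlam k d).1 ↔ x.1 ∈ V_ d.1 ∧ z.1 ∈ V_ d.1 ∧ z.1 ∈ (k x).1 := by
  change pair x.1 z.1 ∈ traceSet k d ↔ _
  unfold traceSet
  refine mem_sep.trans ⟨?_, fun ⟨hx, hz, h⟩ => ⟨pair_mem hlam x.2 z.2, x, z, hx, hz, h, rfl⟩⟩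
  rintro ⟨-, x', z', hx, hz, h, hp⟩
  obtain ⟨h1, h2⟩ := pair_inj.1 hp
  obtain rfl : x = x' := Subtype.ext h1
  obtain rfl : z = z' := Subtype.ext h2
  exact ⟨hx, hz, h⟩

theorem pair_mem_apply_trace (hlam : IsSuccLimit lam) (e k : Emb lam) (d : Set.Iio lam)
    (x z : Rk lam) (hx : x.1 ∈ V_ (e.ord d).1) (hz : z.1 ∈ V_ (e.ord d).1) :
    pair x.1 z.1 ∈ (e (trace hlam k d)).1 ↔ z.1 ∈ (app hlam e k x).1 := by
  have key : FO fun v : Fin 3 → Rk lam => ∀ w : Fin 3 → Rk lam,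
      (w 0).1 ∈ (v 0).1 → (w 1).1 ∈ (v 0).1 → pair (w 0).1 (w 2).1 ∈ (v 1).1 →
        (pair (w 0).1 (w 1).1 ∈ (v 2).1 ↔ (w 1).1 ∈ (w 2).1) :=
    FO.alls ((FO.mem (Sum.inr 0) (Sum.inl 0)).imp ((FO.mem (Sum.inr 1) (Sum.inl 0)).imp
      ((FO.pairMem hlam (Sum.inr 0) (Sum.inr 2) (Sum.inl 1)).imp
        ((FO.pairMem hlam (Sum.inr 0) (Sum.inr 1) (Sum.inl 2)).iff
          (FO.mem (Sum.inr 1) (Sum.inr 2))))))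
  have h1 := (key.map e ![Rk.level d, restrict hlam k d, trace hlam k d]).2 (by
    intro w hx hz hk
    have hk := ((pair_mem_restrict hlam k d _ _).1 hk).2
    rw [← hk]
    exact (pair_mem_trace hlam k d _ _).trans ⟨fun h => h.2.2, fun h => ⟨hx, hz, h⟩⟩)
  have hV : e (Rk.level d) = Rk.level (e.ord d) := e.level_apply hlam d
  refine h1 ![x, z, app hlam e k x] ?_ ?_ ?_
  · change x.1 ∈ (e (Rk.level d)).1
    rwa [hV]
  · change z.1 ∈ (e (Rk.level d)).1
    rwa [hV]
  · exact (pair_mem_apply_restrict hlam e k d _ _).2 ⟨hx, rfl⟩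

/-- Agreement passes to the left argument of application: `k(m)` and `l(m)` are determined up to
`c` by the values of `k` and `l` at the traces of `m` on `V_d`, `d < c`, which belong to `V_c`. -/
theorem Agree.app_left (hlam : IsSuccLimit lam) {c : Set.Iio lam} {k l : Emb lam}
    (h : Agree c k l) (hc : NoMaxBelow c) (m : Emb lam) :
    Agree c (app hlam k m) (app hlam l m) := by
  intro x z hx hz
  obtain ⟨d, hd, hxd, hzd⟩ : ∃ d < c, x.1 ∈ V_ d.1 ∧ z.1 ∈ V_ d.1 := by
    rw [mem_vonNeumann] at hx hz
    have hm : max (rank x.1) (rank z.1) < c.1 := max_lt hx hz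
    obtain ⟨d, hd, hmd⟩ := hc ⟨_, hm.trans c.2⟩ hm
    exact ⟨d, hd, mem_vonNeumann.2 ((le_max_left _ _).trans_lt hmd),
      mem_vonNeumann.2 ((le_max_right _ _).trans_lt hmd)⟩
  have hsucc : succ (succ d.1) < c.1 := by
    obtain ⟨d₁, h₁, hd₁⟩ := hc d hd
    obtain ⟨d₂, h₂, hd₂⟩ := hc d₁ h₁
    have hd₁ : d.1 < d₁.1 := hd₁
    have hd₂ : d₁.1 < d₂.1 := hd₂
    exact (succ_le_of_lt ((succ_le_of_lt hd₁).trans_lt hd₂)).trans_lt h₂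
  have ht : (trace hlam m d).1 ∈ V_ c.1 :=
    mem_vonNeumann.2 ((rank_traceSet_le m d).trans_lt hsucc)
  have hp : pair x.1 z.1 ∈ V_ c.1 :=
    mem_vonNeumann.2 ((rank_pair_lt hxd hzd).trans hsucc)
  have hV : ∀ e : Emb lam, ∀ y : ZFSet.{u}, y ∈ V_ d.1 → y ∈ V_ (e.ord d).1 :=
    fun e _ hy => vonNeumann_subset_of_le (e.le_ord d) hy
  rw [← pair_mem_apply_trace hlam k m d x z (hV k _ hxd) (hV k _ hzd),
    ← pair_mem_apply_trace hlam l m d x z (hV l _ hxd) (hV l _ hzd)]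
  exact h (trace hlam m d) ⟨pair x.1 z.1, pair_mem hlam x.2 z.2⟩ ht hp

/-- Let `f = e(j)`, `g = f(j)` and `h = g(j)`. Up to `c = crit e` the embedding `f` agrees with
`j`, so `f(f)` agrees with `g` up to `f(c)` and `g(f)` agrees with `h` up to `g(c)`. Hence
`e((j(j))(j)) = (f(f))(f)` agrees with `h` up to the smaller of `f(c)` and `g(c)`. The hypotheses
on `a` place `h(a)` below both bounds, because `g(j(a)) = h(g(a))` and `f(j(a)) = g(f(a))`. -/
theorem IsCrit.app_ord_eq (hlam : IsSuccLimit lam) {e : Emb lam} {c : Set.Iio lam}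
    (hc : IsCrit e c) {j f g h : Emb lam} (hf : f = RankEmb.app hlam e j)
    (hg : g = RankEmb.app hlam f j) (hh : h = RankEmb.app hlam g j) {a : Set.Iio lam}
    (ha : a < j.ord a) (hac : j.ord a ≤ c) (hfa : j.ord a ≤ f.ord a) (hga : a < g.ord a) :
    h.ord a = e.ord ((RankEmb.app hlam (RankEmb.app hlam j j) j).ord a) := by
  have h0 : Agree c f j := hf ▸ hc.agree_app hlam j
  have h1 : Agree (f.ord c) (RankEmb.app hlam f f) g := hg ▸ h0.app_right hlam f
  have h2 := h1.app_left hlam (hc.noMaxBelow.ord f) f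
  have h3 : Agree (g.ord c) (RankEmb.app hlam g f) h := hh ▸ h0.app_right hlam g
  have hgc : h.ord a < g.ord c := calc
    h.ord a < h.ord (g.ord a) := h.ord_strictMono hga
    _ = g.ord (j.ord a) := by rw [hh, app_ord]
    _ ≤ g.ord c := g.ord_strictMono.monotone hac
  have hfc : h.ord a < f.ord c := calc
    h.ord a < h.ord (g.ord a) := h.ord_strictMono hga
    _ = g.ord (j.ord a) := by rw [hh, app_ord]
    _ ≤ g.ord (f.ord a) := g.ord_strictMono.monotone hfa
    _ = f.ord (j.ord a) := by rw [hg, app_ord]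
    _ ≤ f.ord c := f.ord_strictMono.monotone hac
  have h4 : Agree (min (f.ord c) (g.ord c)) _ _ :=
    (h2.mono (min_le_left _ _)).trans (h3.mono (min_le_right _ _))
  have h5 := h4.ord_eq (lt_min ((h.le_ord a).trans_lt hfc) ((h.le_ord a).trans_lt hgc))
    (lt_min hfc hgc)
  rw [← h5, ← app_ord hlam, hc.ord_eq (ha.trans_le hac), app_app hlam e,
    app_app hlam e, ← hf]

/-! ### The left powers of `j` -/

theorem jsub_succ (hlam : IsSuccLimit lam) (j : Emb lam) {n : ℕ} (hn : 1 ≤ n) :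
    jsub hlam j (n + 1) = app hlam (jsub hlam j n) j := by
  obtain ⟨m, rfl⟩ := Nat.exists_eq_add_of_le' hn
  rfl

/-- If the iteration of `e` on some ordinal at or below `c` leads above `c`, then `e` moves `c`:
some step of the iteration crosses `c`. -/
theorem Emb.lt_ord_of_iterate (e : Emb lam) {b c : Set.Iio lam} (hb : b ≤ c) (n : ℕ)
    (h : c < e.ord^[n] b) : c < e.ord c := by
  by_contra! hcon
  have : ∀ n, e.ord^[n] b ≤ c := by
    intro n
    induction n with
    | zero => exact hb
    | succ n ih =>
      rw [Function.iterate_succ_apply']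
      exact (e.ord_strictMono.monotone ih).trans hcon
  exact absurd (this n) (not_le.2 h)

end Embeddings
end RankEmb

/-! ### The table -/

theorem mainTheorem5 {lam : Ordinal.{u}} (hlam : Order.IsSuccLimit lam)
    (j : RankEmb.Emb lam) (hj : j ≠ RankEmb.Emb.id lam)
    -- `J n` is `j_(n)`, `κ i` is `κ_i`, `κh` is `κ_{2.5}`, and `K i n` is `κ_i^n = j_(n)(κ_i)`
    (J : ℕ → RankEmb.Emb lam) (hJ : J = RankEmb.jsub hlam j)
    (κ : ℕ → Set.Iio lam) (hκ : κ = RankEmb.kappa hlam j hj)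
    (κh : Set.Iio lam) (hκh : κh = (J 3).ord (κ 1))
    (K : ℕ → ℕ → Set.Iio lam) (hK : ∀ i n, K i n = (J n).ord (κ i)) :
    RankEmb.CritSeqBegins (J 1) [κ 0, κ 1, κ 2, κ 3, κ 4] ∧
    RankEmb.CritSeqBegins (J 2) [κ 1, κ 2, κ 3, κ 4] ∧
    (RankEmb.CritSeqBegins (J 3) [κ 0, κ 2, κ 3, κ 4] ∧ (J 3).ord (κ 1) = κh) ∧
    RankEmb.CritSeqBegins (J 4) [κ 2, κh, κ 3, κ 4] ∧
    RankEmb.CritSeqBegins (J 5) [κ 0, κ 1, κh, κ 4] ∧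
    (RankEmb.CritSeqBegins (J 6) [κ 1, κh, K 2 5] ∧ κ 4 < (J 6).ord (K 2 5)) ∧
    (RankEmb.CritSeqBegins (J 7) [κ 0, κh, K 2 6, K 3 6] ∧ κ 4 < (J 7).ord (K 3 6) ∧
      (J 7).ord (κ 1) = κ 3) ∧
    (RankEmb.CritSeqBegins (J 8) [κh, κ 3, K 2 7, K 3 7] ∧ κ 4 < (J 8).ord (K 3 7)) ∧
    (RankEmb.CritSeqBegins (J 9) [κ 0, κ 1, κ 2, K 2 7] ∧ κ 4 < (J 9).ord (K 2 7)) ∧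
    (RankEmb.CritSeqBegins (J 10) [κ 1, κ 2, K 2 7, K 3 9] ∧ κ 4 < (J 10).ord (K 3 9)) ∧
    (RankEmb.CritSeqBegins (J 11) [κ 0, κ 2, K 2 7, K 3 10] ∧ κ 4 < (J 11).ord (K 3 10) ∧
      (J 11).ord (κ 1) = κ 3) ∧
    (RankEmb.CritSeqBegins (J 12) [κ 2, κ 3, K 2 7, K 3 11] ∧ κ 4 < (J 12).ord (K 3 11)) ∧
    (RankEmb.CritSeqBegins (J 13) [κ 0, κ 1, κ 3, K 2 7] ∧ κ 4 < (J 13).ord (K 2 7)) ∧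
    (RankEmb.CritSeqBegins (J 14) [κ 1, κ 3, K 2 13, K 2 7] ∧ κ 4 < (J 14).ord (K 2 7)) ∧
    (RankEmb.CritSeqBegins (J 15) [κ 0, κ 3, K 2 14, K 2 13] ∧ κ 4 < (J 15).ord (K 2 13)) ∧
    (RankEmb.CritSeqBegins (J 16) [κ 3, K 1 15, K 2 15, K 2 14] ∧
      κ 4 < (J 16).ord (K 2 14)) ∧
    ∀ n, 7 ≤ n → n ≤ 16 → κ 4 < (J (n - 1)).ord (κ 4) := by
  
  subst hκh
  have h1 : J 1 = j := by rw [hJ]; rfl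
  have hsucc : ∀ n, 1 ≤ n → J (n + 1) = RankEmb.app hlam (J n) j := by
    intro n hn
    rw [hJ, RankEmb.jsub_succ hlam j hn]
  have hκs : ∀ i, j.ord (κ i) = κ (i + 1) := by
    intro i
    rw [hκ]
    rfl
  have hcrit1 : RankEmb.IsCrit j (κ 0) := by
    rw [hκ]
    exact RankEmb.isCrit_crit hlam j hj
  have step : ∀ n, 1 ≤ n → ∀ i, (J (n + 1)).ord ((J n).ord (κ i)) = (J n).ord (κ (i + 1)) := by
    intro n hn i
    rw [hsucc n hn, RankEmb.app_ord, hκs]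
  have hcrit : ∀ n, 1 ≤ n → RankEmb.IsCrit (J (n + 1)) ((J n).ord (κ 0)) := by
    intro n hn
    rw [hsucc n hn]
    exact hcrit1.app hlam (J n)
  have hmono : ∀ n, StrictMono (J n).ord := fun n => (J n).ord_strictMono
  have hκlt : ∀ i, κ i < κ (i + 1) := by
    intro i
    induction i with
    | zero => rw [← hκs]; exact hcrit1.lt_ord
    | succ i ih => rw [← hκs i, ← hκs (i + 1)]; exact j.ord_strictMono ih
  have hκm : StrictMono κ := strictMono_nat_of_lt_succ hκlt
  -- Naming: `cn` gives the critical point of `J n`, `vni` its value at `κ i` (with `h` for `κh` and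
  -- `l` for a later ordinal of row `n`), and `mn` says that `J n` moves `κ 4`.
  -- Each row follows from the previous one by `step` and `hcrit`.
  have v1 : ∀ i, (J 1).ord (κ i) = κ (i + 1) := fun i => by rw [h1, hκs]
  have c2 : RankEmb.IsCrit (J 2) (κ 1) := v1 0 ▸ hcrit 1 le_rfl
  have v2 : ∀ i, (J 2).ord (κ (i + 1)) = κ (i + 2) := fun i => by
    have := step 1 le_rfl i
    rwa [v1, v1] at this
  have v20 : (J 2).ord (κ 0) = κ 0 := c2.ord_eq (hκlt 0)
  have c3 : RankEmb.IsCrit (J 3) (κ 0) := v20 ▸ hcrit 2 (by norm_num)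
  have v30 : (J 3).ord (κ 0) = κ 2 := by
    have := step 2 (by norm_num) 0
    rwa [v20, v2] at this
  have v3 : ∀ i, (J 3).ord (κ (i + 2)) = κ (i + 3) := fun i => by
    have := step 2 (by norm_num) (i + 1)
    rwa [v2, v2] at this
  set κh := (J 3).ord (κ 1) with hκh
  have c4 : RankEmb.IsCrit (J 4) (κ 2) := v30 ▸ hcrit 3 (by norm_num)
  have v42 : (J 4).ord (κ 2) = κh := by
    have := step 3 (by norm_num) 0
    rwa [v30] at this
  have v4h : (J 4).ord κh = κ 3 := by
    have := step 3 (by norm_num) 1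
    rwa [v3] at this
  have v43 : (J 4).ord (κ 3) = κ 4 := by
    have := step 3 (by norm_num) 2
    rwa [v3, v3] at this
  have v40 : (J 4).ord (κ 0) = κ 0 := c4.ord_eq (hκm (by norm_num))
  have v41 : (J 4).ord (κ 1) = κ 1 := c4.ord_eq (hκm (by norm_num))
  have h2h : κ 2 < κh := v42 ▸ c4.lt_ord
  have hh3 : κh < κ 3 := by
    have := hmono 4 h2h
    rwa [v42, v4h] at this
  have c5 : RankEmb.IsCrit (J 5) (κ 0) := v40 ▸ hcrit 4 (by norm_num)
  have v50 : (J 5).ord (κ 0) = κ 1 := by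
    have := step 4 (by norm_num) 0
    rwa [v40, v41] at this
  have v51 : (J 5).ord (κ 1) = κh := by
    have := step 4 (by norm_num) 1
    rwa [v41, v42] at this
  have v5h : (J 5).ord κh = κ 4 := by
    have := step 4 (by norm_num) 2
    rwa [v42, v43] at this
  have c6 : RankEmb.IsCrit (J 6) (κ 1) := v50 ▸ hcrit 5 (by norm_num)
  have v61 : (J 6).ord (κ 1) = κh := by
    have := step 5 (by norm_num) 0
    rwa [v50, v51] at this
  have v6h : (J 6).ord κh = (J 5).ord (κ 2) := by
    have := step 5 (by norm_num) 1
    rwa [v51] at this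
  have v6l : κ 4 < (J 6).ord ((J 5).ord (κ 2)) := by
    rw [step 5 (by norm_num) 2, ← v5h]
    exact hmono 5 hh3
  have v60 : (J 6).ord (κ 0) = κ 0 := c6.ord_eq (hκlt 0)
  have h1_4 : κ 1 ≤ κ 4 := (hκm (by norm_num)).le
  have h0_4 : κ 0 ≤ κ 4 := (hκm (by norm_num)).le
  have m6 : κ 4 < (J 6).ord (κ 4) := (J 6).lt_ord_of_iterate h1_4 3 (by
    change κ 4 < (J 6).ord ((J 6).ord ((J 6).ord (κ 1)))
    rwa [v61, v6h])
  -- From row 7 on, the last value in row `n + 1` is `J n (κ 4)`. It exceeds `κ 4` since the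
  -- critical sequence in row `n` starts at or below `κ 4` and ends above it.
  have next : ∀ n, 1 ≤ n → (J n).ord (κ 0) ≤ κ 4 → κ 4 < (J n).ord (κ 4) →
      κ 4 < (J (n + 1)).ord (κ 4) := by
    intro n hn h0 h4
    refine (J (n + 1)).lt_ord_of_iterate h0 4 ?_
    change κ 4 < (J (n + 1)).ord ((J (n + 1)).ord ((J (n + 1)).ord ((J (n + 1)).ord _)))
    rwa [step n hn, step n hn, step n hn, step n hn]
  have last : ∀ n, 1 ≤ n → κ 4 < (J n).ord (κ 4) → κ 4 < (J (n + 1)).ord ((J n).ord (κ 3)) :=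
    fun n hn h => by rwa [step n hn 3]
  have J3 : J 3 = RankEmb.app hlam (RankEmb.app hlam j j) j := by
    rw [hsucc 2 (by norm_num), hsucc 1 le_rfl, h1]
  have c7 : RankEmb.IsCrit (J 7) (κ 0) := v60 ▸ hcrit 6 (by norm_num)
  have v70 : (J 7).ord (κ 0) = κh := by
    have := step 6 (by norm_num) 0
    rwa [v60, v61] at this
  have v7h : (J 7).ord κh = (J 6).ord (κ 2) := by
    have := step 6 (by norm_num) 1
    rwa [v61] at this
  -- `κ 1` is not among the ordinals `J 6 (κ i)`, so `step` says nothing about it. But `J 4 (J 3)`,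
  -- which sends `κ 1` to `J 4 κh = κ 3`, agrees with `J 7` far enough.
  have v71 : (J 7).ord (κ 1) = κ 3 := by
    rw [c4.app_ord_eq hlam (hsucc 4 (by norm_num)) (hsucc 5 (by norm_num)) (hsucc 6 (by norm_num))
      (a := κ 1) (by rw [hκs]; exact hκlt 1) (by rw [hκs]) (by rw [hκs, v51]; exact h2h.le)
      c6.lt_ord, ← J3, ← hκh, v4h]
  have m7 := next 6 (by norm_num) (v60.trans_le h0_4) m6
  have c8 : RankEmb.IsCrit (J 8) κh := v70 ▸ hcrit 7 (by norm_num)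
  have v8h : (J 8).ord κh = κ 3 := by
    have := step 7 (by norm_num) 0
    rwa [v70, v71] at this
  have v83 : (J 8).ord (κ 3) = (J 7).ord (κ 2) := by
    have := step 7 (by norm_num) 1
    rwa [v71] at this
  have v80 : (J 8).ord (κ 0) = κ 0 := c8.ord_eq ((hκm (by norm_num)).trans h2h)
  have v81 : (J 8).ord (κ 1) = κ 1 := c8.ord_eq ((hκlt 1).trans h2h)
  have v82 : (J 8).ord (κ 2) = κ 2 := c8.ord_eq h2h
  have m8 := next 7 (by norm_num) (by rw [v70]; exact (hh3.trans (hκlt 3)).le) m7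
  have c9 : RankEmb.IsCrit (J 9) (κ 0) := v80 ▸ hcrit 8 (by norm_num)
  have v90 : (J 9).ord (κ 0) = κ 1 := by
    have := step 8 (by norm_num) 0
    rwa [v80, v81] at this
  have v91 : (J 9).ord (κ 1) = κ 2 := by
    have := step 8 (by norm_num) 1
    rwa [v81, v82] at this
  have v92 : (J 9).ord (κ 2) = (J 7).ord (κ 2) := by
    have := step 8 (by norm_num) 2
    rwa [v82, v83] at this
  have m9 := next 8 (by norm_num) (v80.trans_le h0_4) m8
  have c10 : RankEmb.IsCrit (J 10) (κ 1) := v90 ▸ hcrit 9 (by norm_num)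
  have v101 : (J 10).ord (κ 1) = κ 2 := by
    have := step 9 (by norm_num) 0
    rwa [v90, v91] at this
  have v102 : (J 10).ord (κ 2) = (J 7).ord (κ 2) := by
    have := step 9 (by norm_num) 1
    rwa [v91, v92] at this
  have v10l : (J 10).ord ((J 7).ord (κ 2)) = (J 9).ord (κ 3) := by
    have := step 9 (by norm_num) 2
    rwa [v92] at this
  have v100 : (J 10).ord (κ 0) = κ 0 := c10.ord_eq (hκlt 0)
  have m10 := next 9 (by norm_num) (v90.trans_le h1_4) m9
  have c11 : RankEmb.IsCrit (J 11) (κ 0) := v100 ▸ hcrit 10 (by norm_num)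
  have v110 : (J 11).ord (κ 0) = κ 2 := by
    have := step 10 (by norm_num) 0
    rwa [v100, v101] at this
  have v112 : (J 11).ord (κ 2) = (J 7).ord (κ 2) := by
    have := step 10 (by norm_num) 1
    rwa [v101, v102] at this
  have v11l : (J 11).ord ((J 7).ord (κ 2)) = (J 10).ord (κ 3) := by
    have := step 10 (by norm_num) 2
    rwa [v102] at this
  -- Again `κ 1` is not of the form `J 10 (κ i)`; now `J 8 (J 3)`, which sends `κ 1` to
  -- `J 8 κh = κ 3`, agrees with `J 11` far enough.
  have v111 : (J 11).ord (κ 1) = κ 3 := by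
    rw [c8.app_ord_eq hlam (hsucc 8 (by norm_num)) (hsucc 9 (by norm_num))
      (hsucc 10 (by norm_num)) (a := κ 1) (by rw [hκs]; exact hκlt 1) (by rw [hκs]; exact h2h.le)
      (by rw [hκs, v91]) c10.lt_ord, ← J3, ← hκh, v8h]
  have m11 := next 10 (by norm_num) (v100.trans_le h0_4) m10
  have c12 : RankEmb.IsCrit (J 12) (κ 2) := v110 ▸ hcrit 11 (by norm_num)
  have v122 : (J 12).ord (κ 2) = κ 3 := by
    have := step 11 (by norm_num) 0
    rwa [v110, v111] at this
  have v123 : (J 12).ord (κ 3) = (J 7).ord (κ 2) := by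
    have := step 11 (by norm_num) 1
    rwa [v111, v112] at this
  have v12l : (J 12).ord ((J 7).ord (κ 2)) = (J 11).ord (κ 3) := by
    have := step 11 (by norm_num) 2
    rwa [v112] at this
  have v120 : (J 12).ord (κ 0) = κ 0 := c12.ord_eq (hκm (by norm_num))
  have v121 : (J 12).ord (κ 1) = κ 1 := c12.ord_eq (hκlt 1)
  have m12 := next 11 (by norm_num) (by rw [v110]; exact (hκm (by norm_num)).le) m11
  have c13 : RankEmb.IsCrit (J 13) (κ 0) := v120 ▸ hcrit 12 (by norm_num)
  have v130 : (J 13).ord (κ 0) = κ 1 := by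
    have := step 12 (by norm_num) 0
    rwa [v120, v121] at this
  have v131 : (J 13).ord (κ 1) = κ 3 := by
    have := step 12 (by norm_num) 1
    rwa [v121, v122] at this
  have v133 : (J 13).ord (κ 3) = (J 7).ord (κ 2) := by
    have := step 12 (by norm_num) 2
    rwa [v122, v123] at this
  have m13 := next 12 (by norm_num) (v120.trans_le h0_4) m12
  have c14 : RankEmb.IsCrit (J 14) (κ 1) := v130 ▸ hcrit 13 (by norm_num)
  have v141 : (J 14).ord (κ 1) = κ 3 := by
    have := step 13 (by norm_num) 0
    rwa [v130, v131] at this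
  have v143 : (J 14).ord (κ 3) = (J 13).ord (κ 2) := by
    have := step 13 (by norm_num) 1
    rwa [v131] at this
  have v14l : (J 14).ord ((J 13).ord (κ 2)) = (J 7).ord (κ 2) := by
    have := step 13 (by norm_num) 2
    rwa [v133] at this
  have v140 : (J 14).ord (κ 0) = κ 0 := c14.ord_eq (hκlt 0)
  have m14 := next 13 (by norm_num) (v130.trans_le h1_4) m13
  have c15 : RankEmb.IsCrit (J 15) (κ 0) := v140 ▸ hcrit 14 (by norm_num)
  have v150 : (J 15).ord (κ 0) = κ 3 := by
    have := step 14 (by norm_num) 0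
    rwa [v140, v141] at this
  have v153 : (J 15).ord (κ 3) = (J 14).ord (κ 2) := by
    have := step 14 (by norm_num) 1
    rwa [v141] at this
  have v15l : (J 15).ord ((J 14).ord (κ 2)) = (J 13).ord (κ 2) := by
    have := step 14 (by norm_num) 2
    rwa [v143] at this
  have m15 := next 14 (by norm_num) (v140.trans_le h0_4) m14
  have c16 : RankEmb.IsCrit (J 16) (κ 3) := v150 ▸ hcrit 15 (by norm_num)
  have v163 : (J 16).ord (κ 3) = (J 15).ord (κ 1) := by
    have := step 15 (by norm_num) 0
    rwa [v150] at this
  have v16l : (J 16).ord ((J 15).ord (κ 2)) = (J 14).ord (κ 2) := by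
    have := step 15 (by norm_num) 2
    rwa [v153] at this
  simp only [hK, RankEmb.CritSeqBegins, List.isChain_cons_cons, List.isChain_singleton, and_true]
  refine ⟨⟨h1 ▸ hcrit1, v1 0, v1 1, v1 2, v1 3⟩, ⟨c2, v2 0, v2 1, v2 2⟩,
    ⟨c3, v30, v3 0, v3 1⟩, ⟨c4, v42, v4h, v43⟩,
    ⟨c5, v50, v51, v5h⟩, ⟨⟨c6, v61, v6h⟩, v6l⟩,
    ⟨⟨c7, v70, v7h, step 6 (by norm_num) 2⟩, last 6 (by norm_num) m6, v71⟩,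
    ⟨⟨c8, v8h, v83, step 7 (by norm_num) 2⟩, last 7 (by norm_num) m7⟩,
    ⟨⟨c9, v90, v91, v92⟩, ?_⟩,
    ⟨⟨c10, v101, v102, v10l⟩, last 9 (by norm_num) m9⟩,
    ⟨⟨c11, v110, v112, v11l⟩, last 10 (by norm_num) m10, v111⟩,
    ⟨⟨c12, v122, v123, v12l⟩, last 11 (by norm_num) m11⟩,
    ⟨⟨c13, v130, v131, v133⟩, ?_⟩, ⟨⟨c14, v141, v143, v14l⟩, ?_⟩,
    ⟨⟨c15, v150, v153, v15l⟩, ?_⟩,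
    ⟨⟨c16, v163, step 15 (by norm_num) 1, v16l⟩, ?_⟩, ?_⟩
  · rw [← v83]
    exact last 8 (by norm_num) m8
  · rw [← v123]
    exact last 12 (by norm_num) m12
  · rw [← v133]
    exact last 13 (by norm_num) m13
  · rw [← v143]
    exact last 14 (by norm_num) m14
  · rw [← v153]
    exact last 15 (by norm_num) m15
  · intro n hn hn'
    interval_cases n
    exacts [m6, m7, m8, m9, m10, m11, m12, m13, m14, m15]
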